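/- For an $m\times n$ real matrix $B=(b_{ij})$ with $m\le n$, let $\operatorname{perm} B=\sum_{\pi}\prod_{i=1}^{m} b_{i,\pi(i)}$, where $\pi$ ranges over all one-to-one functions from $\{1,\dots,m\}$ to $\{1,\dots,n\}$. A $k_1\times k_2$ submatrix of $A=(a_{ij})$ is a matrix $(a_{ij})_{i\in I,\,j\in J}$ with $I$ a set of $k_1$ row indices and $J$ a set of $k_2$ column indices. **Theorem.** Let $\xi$ be an (almost surely) positive random variable, and let $(m_n)_n$ be non-negative integers with $m_n\le n$ and $$\liminf_{n\to\infty}\frac{m_n\log\log n}{(\log n)^2}>1 ,$$ where the value $+\infty$ is allowed. Let $(A_n)_n$ be a sequence of random matrices on a common probability space such that, for each $n$, $A_n$ is an $m_n\times n$ matrix whose entries are independent and distributed as $\xi$ (the joint law of different matrices is arbitrary). Let $0<\alpha<1$. (i) Almost surely, $$\liminf_{n\to\infty}\ \min_{(k_1,k_2,B)}\frac{\log\operatorname{perm} B}{k_1\log k_2}\ \ge\ 1 .$$ (ii) If $\xi$ has a finite mean, then almost surely $$\limsup_{n\to\infty}\ \max_{(k_1,k_2,B)}\frac{\log\operatorname{perm}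 B}{k_1\log k_2}\ =\ 1 .$$ In both parts the minimum (respectively the maximum) is taken over all pairs of integers $(k_1,k_2)$ with $\alpha m_n\le k_1\le m_n$, $\alpha n\le k_2\le n$ and $k_1\le k_2$, and over all $k_1\times k_2$ submatrices $B$ of $A_n$; the liminf in (i) may be $+\infty$. -/

import Mathlib

open MeasureTheory ProbabilityTheory Filter

noncomputable section

/-- The permanent of a (possibly rectangular) matrix: the sum, over all one-to-one maps `π` from the
rows to the columns, of the products `∏ i, A i (π i)`. -/
def rectPerm {ι κ : Type*} [Fintype ι] [DecidableEq ι] [Fintype κ] [DecidableEq κ]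
    (A : Matrix ι κ ℝ) : ℝ :=
  ∑ π : ι ↪ κ, ∏ i, A i (π i)

/-- The submatrix of `A` with rows in `I` and columns in `J`. -/
def subMat {m n : ℕ} (A : Matrix (Fin m) (Fin n) ℝ) (I : Finset (Fin m)) (J : Finset (Fin n)) :
    Matrix I J ℝ :=
  A.submatrix Subtype.val Subtype.val

/-- The sizes `k₁ = #I`, `k₂ = #J` satisfy `α m ≤ k₁ (≤ m)`, `α n ≤ k₂ (≤ n)` and `k₁ ≤ k₂`. -/
def LinearSize (α : ℝ) {m n : ℕ} (I : Finset (Fin m)) (J : Finset (Fin n)) : Prop :=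
  α * m ≤ I.card ∧ α * n ≤ J.card ∧ I.card ≤ J.card

/-- `log (perm B) / (k₁ log k₂)` for the `k₁ × k₂` submatrix `B` with rows `I` and columns `J`. -/
def logPermRatio {m n : ℕ} (A : Matrix (Fin m) (Fin n) ℝ)
    (I : Finset (Fin m)) (J : Finset (Fin n)) : ℝ :=
  Real.log (rectPerm (subMat A I J)) / (I.card * Real.log J.card)

/-- The minimum of `log (perm B) / (k₁ log k₂)` over all submatrices `B` of linear size. -/
def minLogPermRatio (α : ℝ) {m n : ℕ} (A : Matrix (Fin m) (Fin n) ℝ) : EReal :=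
  ⨅ (p : Finset (Fin m) × Finset (Fin n)) (_ : LinearSize α p.1 p.2),
    (logPermRatio A p.1 p.2 : EReal)

/-- The maximum of `log (perm B) / (k₁ log k₂)` over all submatrices `B` of linear size. -/
def maxLogPermRatio (α : ℝ) {m n : ℕ} (A : Matrix (Fin m) (Fin n) ℝ) : EReal :=
  ⨆ (p : Finset (Fin m) × Finset (Fin n)) (_ : LinearSize α p.1 p.2),
    (logPermRatio A p.1 p.2 : EReal)

theorem linearSize_univ {α : ℝ} (hα : α ≤ 1) {m n : ℕ} (hmn : m ≤ n) :
    LinearSize α (Finset.univ : Finset (Fin m)) (Finset.univ : Finset (Fin n)) := by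
  refine ⟨?_, ?_, ?_⟩
  · simpa using mul_le_of_le_one_left (Nat.cast_nonneg m) hα
  · simpa using mul_le_of_le_one_left (Nat.cast_nonneg n) hα
  · simpa using hmn

/-- The infimum is a genuine minimum. -/
theorem exists_eq_minLogPermRatio {α : ℝ} (hα : α ≤ 1) {m n : ℕ} (hmn : m ≤ n)
    (A : Matrix (Fin m) (Fin n) ℝ) :
    ∃ p : Finset (Fin m) × Finset (Fin n), LinearSize α p.1 p.2 ∧
      minLogPermRatio α A = (logPermRatio A p.1 p.2 : EReal) := by
  have hne : {p : Finset (Fin m) × Finset (Fin n) | LinearSize α p.1 p.2}.Nonempty :=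
    ⟨(Finset.univ, Finset.univ), linearSize_univ hα hmn⟩
  obtain ⟨p, hp, h⟩ := (Set.toFinite {p : Finset (Fin m) × Finset (Fin n) |
    LinearSize α p.1 p.2}).exists_minimalFor
      (fun p => (logPermRatio A p.1 p.2 : EReal)) _ hne
  refine ⟨p, hp, le_antisymm (iInf₂_le p hp) (le_iInf₂ fun q hq => ?_)⟩
  exact (le_total (logPermRatio A p.1 p.2 : EReal) (logPermRatio A q.1 q.2)).elim id
    fun hle => h hq hle

/-- The supremum is a genuine maximum. -/
theorem exists_eq_maxLogPermRatio {α : ℝ} (hα : α ≤ 1) {m n : ℕ} (hmn : m ≤ n)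
    (A : Matrix (Fin m) (Fin n) ℝ) :
    ∃ p : Finset (Fin m) × Finset (Fin n), LinearSize α p.1 p.2 ∧
      maxLogPermRatio α A = (logPermRatio A p.1 p.2 : EReal) := by
  have hne : {p : Finset (Fin m) × Finset (Fin n) | LinearSize α p.1 p.2}.Nonempty :=
    ⟨(Finset.univ, Finset.univ), linearSize_univ hα hmn⟩
  obtain ⟨p, hp, h⟩ := (Set.toFinite {p : Finset (Fin m) × Finset (Fin n) |
    LinearSize α p.1 p.2}).exists_maximalFor
      (fun p => (logPermRatio A p.1 p.2 : EReal)) _ hne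
  refine ⟨p, hp, le_antisymm (iSup₂_le fun q hq => ?_) (le_iSup₂_of_le p hp le_rfl)⟩
  exact (le_total (logPermRatio A q.1 q.2 : EReal) (logPermRatio A p.1 p.2)).elim id
    fun hle => h hq hle

end

/-! Both bounds come from events about the whole matrix that control all submatrices at once, so no
union bound over submatrices is needed. The height condition enters only as `log n < m n` for large
`n`.

Lower bound: choose `a > 0` so that an entry is below `a` with tiny probability. Almost surely, for
large `n`, every row and column of `A n` has only a small proportion of entries below `a`. In a `k₁
× k₂` submatrix, about `(1 - ε) k₁` rows can then be matched greedily to entries at least `a`, with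
a fixed proportion of the `k₂` columns free at every stage. Hall's theorem extends each partial
matching to all rows (`exists_embedding_extension`). Hence the permanent is at least about `(c k₂) ^
((1 - ε) k₁) * a ^ k₁`, with `c` depending only on `ε`.

Upper bound: the permanent is at most the product of the row sums. With entries replaced by `1 +
|x|`, this product has mean `(n C) ^ m`, and Markov's inequality with Borel–Cantelli bounds it by `n
^ ((1 + ε) m)`. The added 1 makes every row sum at least `n`, so the rows omitted from a submatrix
can be divided out. -/

/-! ### Matchings and bounds for permanents -/

/-- Greedy count of the injections whose graph is contained in a relation all of whose sections
are large. -/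
theorem pow_card_le_card_embedding {κ : Type*} [Finite κ] (d : ℕ) {α : Type*} [Finite α]
    (G : α → κ → Prop) (h : ∀ i, d + Nat.card α ≤ {j | G i j}.ncard) :
    d ^ Nat.card α ≤ Nat.card {f : α ↪ κ // ∀ i, G i (f i)} := by
  induction α using Finite.induction_empty_option with
  | @of_equiv α β e ih =>
    have := ih (fun i => G (e i)) fun i => by
      rw [Nat.card_congr e]; exact h (e i)
    rw [Nat.card_congr e] at this
    refine this.trans (Nat.card_le_card_of_injective
      (fun f => ⟨e.symm.toEmbedding.trans f.1, fun i => ?_⟩) ?_)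
    · have := f.2 (e.symm i)
      rwa [e.apply_symm_apply] at this
    · intro f g hfg
      apply Subtype.ext
      ext i
      simpa using DFunLike.congr_fun (congrArg Subtype.val hfg) (e i)
  | h_empty =>
    have : Nonempty {f : PEmpty ↪ κ // ∀ i, G i (f i)} :=
      ⟨⟨Function.Embedding.ofIsEmpty, fun i => i.elim⟩⟩
    simp
  | @h_option α _ ih =>
    have hα : Nat.card (Option α) = Nat.card α + 1 := Finite.card_option
    have ih' := ih (fun i => G (some i)) fun i => by
      have := h (some i); omega
    -- The other rows occupy only `Nat.card α` columns, so at least `d` remain for the new row.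
    have key : ∀ f : {f : α ↪ κ // ∀ i, G (some i) (f i)},
        d ≤ Nat.card {j // G none j ∧ j ∉ Set.range f.1} := fun f => by
      have h1 := h none
      have h2 := Set.le_ncard_sdiff (Set.range f.1) {j | G none j}
      have h3 : (Set.range f.1).ncard = Nat.card α := by
        rw [← Set.image_univ, Set.ncard_image_of_injective _ f.1.injective, Set.ncard_univ]
      have h4 : Nat.card {j // G none j ∧ j ∉ Set.range f.1} =
        ({j | G none j} \ Set.range f.1).ncard := rfl
      omega
    have : Fintype {f : α ↪ κ // ∀ i, G (some i) (f i)} := Fintype.ofFinite _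
    calc d ^ Nat.card (Option α) = d ^ Nat.card α * d := by rw [hα, pow_succ]
      _ ≤ Nat.card {f : α ↪ κ // ∀ i, G (some i) (f i)} * d := Nat.mul_le_mul_right _ ih'
      _ ≤ ∑ f : {f : α ↪ κ // ∀ i, G (some i) (f i)},
          Nat.card {j // G none j ∧ j ∉ Set.range f.1} := by
        rw [Nat.card_eq_fintype_card, ← smul_eq_mul]
        exact Finset.card_nsmul_le_sum _ _ _ fun f _ => key f
      _ = Nat.card (Σ f : {f : α ↪ κ // ∀ i, G (some i) (f i)},
          {j // G none j ∧ j ∉ Set.range f.1}) := Nat.card_sigma.symm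
      _ ≤ _ := by
        refine Nat.card_le_card_of_injective
          (fun p => ⟨Function.Embedding.optionElim p.1.1 p.2.1 p.2.2.2, ?_⟩) ?_
        · rintro (_ | i)
          · exact p.2.2.1
          · exact p.1.2 i
        · rintro ⟨⟨f, hf⟩, j, hj⟩ ⟨⟨g, hg⟩, k, hk⟩ hfg
          have hfg' := congrArg Subtype.val hfg
          obtain rfl : f = g := by
            ext i
            exact DFunLike.congr_fun hfg' (some i)
          obtain rfl : j = k := DFunLike.congr_fun hfg' none
          rfl

open scoped Classical in
/-- Hall's theorem completes a partial matching if the relation misses few entries in each row and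
in each column. -/
theorem exists_embedding_extension {ι κ : Type*} [Fintype ι] [Fintype κ] (G : ι → κ → Prop)
    {β γ : ℕ} (s : Finset ι) (hικ : Fintype.card ι ≤ Fintype.card κ)
    (hrow : ∀ i, {j | ¬ G i j}.ncard ≤ β) (hcol : ∀ j, {i | ¬ G i j}.ncard ≤ γ)
    (hs : β + γ + s.card ≤ Fintype.card κ) (f : s ↪ κ) (hf : ∀ i : s, G i (f i)) :
    ∃ g : ι ↪ κ, (∀ i : s, g i = f i) ∧ ∀ i, G i (g i) := by
  have hfc : (Finset.univ.map f).card = s.card := by simp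
  let t : {i // i ∉ s} → Finset κ := fun i => ({j | G i j} : Finset κ) \ Finset.univ.map f
  obtain ⟨g, hg, hgt⟩ := (Finset.all_card_le_biUnion_card_iff_exists_injective t).1 fun S => by
    rcases S.eq_empty_or_nonempty with rfl | ⟨i, hi⟩
    · simp
    -- Hall's condition: for a small `S`, one row already has at least `γ` admissible columns
    -- outside the image of `f`. For a larger `S`, no free column is missed by all of `S`, so the
    -- neighbourhood consists of all free columns.
    by_cases hS : S.card ≤ γ
    · have h1 : (t i).card ≤ (S.biUnion t).card :=
        Finset.card_le_card (Finset.subset_biUnion_of_mem t hi)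
      have h2 : Finset.card ({j | G i j} : Finset κ) - (Finset.univ.map f).card ≤ (t i).card :=
        Finset.le_card_sdiff _ _
      have h3 : Finset.card ({j | G i j} : Finset κ) + Finset.card ({j | ¬ G i j} : Finset κ) =
          Fintype.card κ := Finset.card_filter_add_card_filter_not (s := Finset.univ) (G i)
      have h4 : Finset.card ({j | ¬ G i j} : Finset κ) ≤ β := by
        rw [← Set.ncard_coe_finset]
        simpa using hrow i
      omega
    · have h1 : (Finset.univ.map f)ᶜ ⊆ S.biUnion t := fun j hj => by
        by_contra hcon
        refine hS ((Finset.card_map (Function.Embedding.subtype _)).symm.trans_le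
          (le_trans ?_ (hcol j)))
        rw [← Set.ncard_coe_finset]
        refine Set.ncard_le_ncard ?_
        intro x hx
        obtain ⟨x, hx', rfl⟩ := Finset.mem_map.1 hx
        intro hG
        refine hcon (Finset.mem_biUnion.2 ⟨x, hx', ?_⟩)
        exact Finset.mem_sdiff.2 ⟨by simpa using hG, Finset.mem_compl.1 hj⟩
      have h2 := Finset.card_le_card h1
      rw [Finset.card_compl, hfc] at h2
      have h3 := Finset.card_le_univ S
      rw [Fintype.card_subtype_compl, Fintype.card_coe] at h3
      omega
  have hgG : ∀ i : {i // i ∉ s}, G i (g i) := fun i => by simpa using (Finset.mem_sdiff.1 (hgt i)).1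
  have hgf : ∀ i k, f k ≠ g i := fun i k h =>
    (Finset.mem_sdiff.1 (hgt i)).2 (Finset.mem_map.2 ⟨k, Finset.mem_univ _, h⟩)
  let e : ι → κ := fun i => if h : i ∈ s then f ⟨i, h⟩ else g ⟨i, h⟩
  have he₁ : ∀ i (h : i ∈ s), e i = f ⟨i, h⟩ := fun i h => dif_pos h
  have he₂ : ∀ i (h : i ∉ s), e i = g ⟨i, h⟩ := fun i h => dif_neg h
  have he : Function.Injective e := fun i j hij => by
    by_cases hi : i ∈ s <;> by_cases hj : j ∈ s
    · rw [he₁ i hi, he₁ j hj] at hij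
      exact congrArg Subtype.val (f.injective hij)
    · rw [he₁ i hi, he₂ j hj] at hij
      exact (hgf _ _ hij).elim
    · rw [he₂ i hi, he₁ j hj] at hij
      exact (hgf _ _ hij.symm).elim
    · rw [he₂ i hi, he₂ j hj] at hij
      exact congrArg Subtype.val (hg hij)
  refine ⟨⟨e, he⟩, fun i => he₁ i i.2, fun i => ?_⟩
  change G i (e i)
  by_cases hi : i ∈ s
  · rw [he₁ i hi]
    exact hf ⟨i, hi⟩
  · rw [he₂ i hi]
    exact hgG ⟨i, hi⟩

/-- A lower bound for the permanent of a nonnegative matrix which has few entries below `a` in each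
row and in each column. -/
theorem pow_mul_pow_le_rectPerm {ι κ : Type*} [Fintype ι] [DecidableEq ι] [Fintype κ]
    [DecidableEq κ] {B : Matrix ι κ ℝ} {a : ℝ} (ha : 0 < a) (hB : ∀ i j, 0 ≤ B i j)
    {β γ r : ℕ} (hr : r ≤ Fintype.card ι) (hικ : Fintype.card ι ≤ Fintype.card κ)
    (hrow : ∀ i, {j | B i j < a}.ncard ≤ β) (hcol : ∀ j, {i | B i j < a}.ncard ≤ γ)
    (hβγ : β + γ + r ≤ Fintype.card κ) :
    ((Fintype.card κ - β - r : ℕ) : ℝ) ^ r * a ^ Fintype.card ι ≤ rectPerm B := by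
  classical
  obtain ⟨s, -, hs⟩ := Finset.exists_subset_card_eq (s := (Finset.univ : Finset ι)) hr
  let G : ι → κ → Prop := fun i j => a ≤ B i j
  have hcount : (Fintype.card κ - β - r) ^ r ≤ Fintype.card {f : ι ↪ κ // ∀ i, G i (f i)} := by
    have h1 := pow_card_le_card_embedding (κ := κ) (Fintype.card κ - β - r)
      (fun (i : s) j => G i j) fun i => by
        have h2 := Set.ncard_add_ncard_compl {j | G i j}
        have h3 : {j | G i j}ᶜ = {j | B i j < a} := by ext j; simp [G]
        have h4 := hrow i
        rw [h3, Nat.card_eq_fintype_card] at h2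
        rw [Nat.card_eq_fintype_card, Fintype.card_coe, hs]
        omega
    rw [Nat.card_eq_fintype_card, Fintype.card_coe, hs] at h1
    have hext := fun f : {f : s ↪ κ // ∀ i : s, G i (f i)} =>
      exists_embedding_extension G (β := β) (γ := γ) s hικ (by simpa [G] using hrow)
        (by simpa [G] using hcol) (by omega) f.1 f.2
    choose g hgf hgG using hext
    rw [← Nat.card_eq_fintype_card (α := {f : ι ↪ κ // ∀ i, G i (f i)})]
    -- Restricting the extension to `s` recovers the partial matching, so nothing is counted twice.
    refine h1.trans (Nat.card_le_card_of_injective (fun f => ⟨g f, hgG f⟩) fun f f' h => ?_)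
    apply Subtype.ext
    ext i
    rw [← hgf f i, ← hgf f' i]
    exact DFunLike.congr_fun (congrArg Subtype.val h) _
  calc ((Fintype.card κ - β - r : ℕ) : ℝ) ^ r * a ^ Fintype.card ι
      ≤ (Finset.card {f : ι ↪ κ | ∀ i, G i (f i)}) * a ^ Fintype.card ι := by
        rw [← Fintype.card_subtype]
        gcongr
        exact_mod_cast hcount
    _ = ∑ f : ι ↪ κ with ∀ i, G i (f i), a ^ Fintype.card ι := by simp
    _ ≤ ∑ f : ι ↪ κ with ∀ i, G i (f i), ∏ i, B i (f i) := by
        refine Finset.sum_le_sum fun f hf => ?_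
        rw [← Finset.card_univ, ← Finset.prod_const]
        exact Finset.prod_le_prod (fun _ _ => ha.le) fun i _ => (Finset.mem_filter.1 hf).2 i
    _ ≤ rectPerm B := Finset.sum_le_sum_of_subset_of_nonneg (Finset.filter_subset _ _)
        fun f _ _ => Finset.prod_nonneg fun i _ => hB i (f i)

/-- The permanent of a nonnegative matrix is at most the product of its row sums. -/
theorem rectPerm_le_prod_sum {ι κ : Type*} [Fintype ι] [DecidableEq ι] [Fintype κ]
    [DecidableEq κ] {B : Matrix ι κ ℝ} (hB : ∀ i j, 0 ≤ B i j) :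
    rectPerm B ≤ ∏ i, ∑ j, B i j := by
  have h := Finset.prod_univ_sum (fun _ : ι => (Finset.univ : Finset κ)) fun i j => B i j
  rw [Fintype.piFinset_univ] at h
  rw [h, rectPerm]
  refine (Finset.sum_map Finset.univ ⟨fun f : ι ↪ κ => (f : ι → κ), DFunLike.coe_injective⟩
    (fun f : ι → κ => ∏ i, B i (f i))).symm.trans_le ?_
  exact Finset.sum_le_sum_of_subset_of_nonneg (Finset.subset_univ _)
    fun f _ _ => Finset.prod_nonneg fun i _ => hB i (f i)

/-! ### General probability estimates -/

section Probability

variable {Ω : Type*} [MeasurableSpace Ω] {P : Measure Ω}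

/-- Borel–Cantelli for events of probability at most `1 / n ^ 2`. -/
theorem ae_eventually_notMem_of_le_inv_sq {s : ℕ → Set Ω}
    (h : ∀ᶠ n : ℕ in atTop, P (s n) ≤ ENNReal.ofReal (1 / (n : ℝ) ^ 2)) :
    ∀ᵐ ω ∂P, ∀ᶠ n in atTop, ω ∉ s n := by
  obtain ⟨N, hN⟩ := eventually_atTop.1 h
  have hsum : Summable fun n : ℕ => 1 / ((n + N : ℕ) : ℝ) ^ 2 :=
    (summable_nat_add_iff N).2 (Real.summable_one_div_nat_pow.2 one_lt_two)
  have := ae_eventually_notMem (μ := P) (s := fun n => s (n + N))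
    ((ENNReal.tsum_le_tsum fun n => hN (n + N) (Nat.le_add_left N n)).trans_lt
      hsum.tsum_ofReal_lt_top).ne
  filter_upwards [this] with ω hω
  obtain ⟨M, hM⟩ := eventually_atTop.1 hω
  filter_upwards [eventually_ge_atTop (M + N)] with n hn
  have := hM (n - N) (by omega)
  rwa [Nat.sub_add_cancel (by omega)] at this

/-- Union bound for the number of small values among independent random variables. -/
theorem measure_lt_card_lt_le {ι : Type*} [Fintype ι] {X : ι → Ω → ℝ} (hX : iIndepFun X P)
    {a : ℝ} {p : ENNReal} (hp : p ≤ 1) (h : ∀ i, P (X i ⁻¹' Set.Iio a) ≤ p) (t : ℝ) :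
    P {ω | t < ({i | X i ω < a}.ncard : ℝ)} ≤ 2 ^ Fintype.card ι * p ^ t := by
  classical
  have hsub : {ω | t < ({i | X i ω < a}.ncard : ℝ)} ⊆
      ⋃ S ∈ ({S | t < S.card} : Finset (Finset ι)), ⋂ i ∈ S, X i ⁻¹' Set.Iio a := by
    intro ω hω
    have hcard : t < (Finset.card ({i | X i ω < a} : Finset ι) : ℝ) := by
      rw [← Set.ncard_coe_finset]
      simpa using hω
    simp only [Set.mem_iUnion]
    exact ⟨_, by simpa using hcard, by simp⟩
  calc P {ω | t < ({i | X i ω < a}.ncard : ℝ)}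
      ≤ ∑ S ∈ ({S | t < S.card} : Finset (Finset ι)), P (⋂ i ∈ S, X i ⁻¹' Set.Iio a) :=
        (measure_mono hsub).trans (measure_biUnion_finset_le _ _)
    _ ≤ ∑ S ∈ ({S | t < S.card} : Finset (Finset ι)), p ^ t := by
        refine Finset.sum_le_sum fun S hS => ?_
        rw [hX.measure_inter_preimage_eq_mul S fun _ _ => measurableSet_Iio]
        refine (Finset.prod_le_pow_card S _ p fun i _ => h i).trans ?_
        rw [← ENNReal.rpow_natCast]
        exact ENNReal.rpow_le_rpow_of_exponent_ge hp (Finset.mem_filter.1 hS).2.le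
    _ ≤ 2 ^ Fintype.card ι * p ^ t := by
        rw [Finset.sum_const, nsmul_eq_mul]
        gcongr
        refine (Nat.cast_le.2 (Finset.card_filter_le _ _)).trans ?_
        simp

/-- A positive random variable is unlikely to be small. -/
theorem exists_measure_lt_le [IsFiniteMeasure P] {X : Ω → ℝ} (hX : AEMeasurable X P)
    (hpos : ∀ᵐ ω ∂P, 0 < X ω) {p : ENNReal} (hp : 0 < p) :
    ∃ a : ℝ, 0 < a ∧ P (X ⁻¹' Set.Iio a) ≤ p := by
  -- Continuity from above: the events `X < 1 / (n + 1)` decrease to a null set.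
  have h := tendsto_measure_iInter_atTop (μ := P)
    (s := fun n : ℕ => X ⁻¹' Set.Iio (1 / ((n : ℝ) + 1)))
    (fun n => hX.nullMeasurableSet_preimage measurableSet_Iio)
    (fun k n hkn => Set.preimage_mono (Set.Iio_subset_Iio (Nat.one_div_le_one_div hkn)))
    ⟨0, measure_ne_top _ _⟩
  have h0 : P (⋂ n : ℕ, X ⁻¹' Set.Iio (1 / ((n : ℝ) + 1))) = 0 := by
    refine measure_mono_null (fun ω hω => ?_) (ae_iff.1 hpos)
    intro h0
    obtain ⟨n, hn⟩ := exists_nat_one_div_lt h0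
    exact lt_asymm hn (Set.mem_iInter.1 hω n)
  rw [h0] at h
  obtain ⟨n, hn⟩ := (h.eventually_lt_const hp).exists
  exact ⟨1 / ((n : ℝ) + 1), by positivity, hn.le⟩

/-- Expectation of the product of the row sums of a random matrix with independent entries. -/
theorem lintegral_prod_sum_eq {ι κ : Type*} [Fintype ι] [Fintype κ] {X : ι × κ → Ω → ENNReal}
    [IsProbabilityMeasure P]
    (hX : iIndepFun X P) (hm : ∀ i, AEMeasurable (X i) P) {c : ENNReal}
    (hc : ∀ i, ∫⁻ ω, X i ω ∂P = c) :
    ∫⁻ ω, ∏ i, ∑ j, X (i, j) ω ∂P = (Fintype.card κ * c) ^ Fintype.card ι := by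
  classical
  have h : ∀ ω, ∏ i, ∑ j, X (i, j) ω = ∑ f : ι → κ, ∏ i, X (i, f i) ω := fun ω => by
    have h := Finset.prod_univ_sum (fun _ : ι => (Finset.univ : Finset κ)) fun i j => X (i, j) ω
    rwa [Fintype.piFinset_univ] at h
  simp_rw [h]
  rw [lintegral_finsetSum' _ fun f _ => Finset.aemeasurable_fun_prod _ fun i _ => hm _]
  have hf : ∀ f : ι → κ, ∫⁻ ω, ∏ i, X (i, f i) ω ∂P = c ^ Fintype.card ι := fun f => by
    -- Each product takes one entry per row, hence distinct entries, even if `f` is not injective.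
    have hinj : Function.Injective fun i => (i, f i) := fun i j hij => congrArg Prod.fst hij
    have hmk := fun i => (hm (i, f i)).ae_eq_mk
    have hind := (hX.precomp hinj).congr hmk
    calc ∫⁻ ω, ∏ i, X (i, f i) ω ∂P = ∫⁻ ω, ∏ i, (hm (i, f i)).mk _ ω ∂P := by
          refine lintegral_congr_ae ?_
          filter_upwards [ae_all_iff.2 hmk] with ω hω
          exact Finset.prod_congr rfl fun i _ => hω i
      _ = ∏ i, ∫⁻ ω, (hm (i, f i)).mk _ ω ∂P :=
          lintegral_prod_eq_prod_lintegral_of_indepFun _ _ hind fun i => (hm _).measurable_mk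
      _ = c ^ Fintype.card ι := by
          rw [← Finset.card_univ]
          refine Finset.prod_eq_pow_card fun i _ => ?_
          rw [← hc (i, f i)]
          exact lintegral_congr_ae (hmk i).symm
  simp_rw [hf]
  simp [mul_pow]

end Probability

/-! ### From conditions on the whole matrix to all large submatrices -/

section Deterministic

variable {m n : ℕ} {A : Matrix (Fin m) (Fin n) ℝ} {α ε : ℝ}

theorem ncard_subtype_le {ι : Type*} [Finite ι] (s : Finset ι) (p : ι → Prop) :
    {i : s | p i}.ncard ≤ {i | p i}.ncard :=
  Set.ncard_le_ncard_of_injOn Subtype.val (fun _ h => h) Subtype.val_injective.injOn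

/-- The bound `pow_mul_pow_le_rectPerm` for a submatrix, in terms of the whole matrix. -/
theorem pow_mul_pow_le_rectPerm_subMat (hA : ∀ i j, 0 ≤ A i j) {a : ℝ} (ha : 0 < a)
    {β γ r : ℕ} (hrow : ∀ i, {j | A i j < a}.ncard ≤ β) (hcol : ∀ j, {i | A i j < a}.ncard ≤ γ)
    {I : Finset (Fin m)} {J : Finset (Fin n)} (hr : r ≤ I.card) (hle : I.card ≤ J.card)
    (hβγ : β + γ + r ≤ J.card) :
    ((J.card - β - r : ℕ) : ℝ) ^ r * a ^ I.card ≤ rectPerm (subMat A I J) := by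
  have := pow_mul_pow_le_rectPerm (B := subMat A I J) (β := β) (γ := γ) (r := r) ha
    (fun i j => hA i j) (by rwa [Fintype.card_coe])
    (by rwa [Fintype.card_coe, Fintype.card_coe])
    (fun i => (ncard_subtype_le J fun j => A i j < a).trans (hrow i))
    (fun j => (ncard_subtype_le I fun i => A i j < a).trans (hcol j))
    (by rwa [Fintype.card_coe])
  rwa [Fintype.card_coe, Fintype.card_coe] at this

/-- A lower bound for `logPermRatio` if every row and every column has few small entries. -/
theorem one_sub_le_logPermRatio (hmn : m ≤ n) (hA : ∀ i j, 0 ≤ A i j) {a : ℝ} (ha : 0 < a)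
    (hα : 0 < α) (hε : 0 < ε) (hε₁ : ε ≤ 1 / 4)
    (hrow : ∀ i, ({j | A i j < a}.ncard : ℝ) ≤ ε * α / 3 * n)
    (hcol : ∀ j, ({i | A i j < a}.ncard : ℝ) ≤ ε * α / 3 * m)
    (hm : 1 ≤ ε * (α * m)) (hn : 1 < α * n)
    (hlogε : Real.log (3 / (2 * ε)) ≤ ε * Real.log (α * n))
    (hloga : -Real.log a ≤ ε * Real.log (α * n))
    {I : Finset (Fin m)} {J : Finset (Fin n)} (hIJ : LinearSize α I J) :
    1 - 4 * ε ≤ logPermRatio A I J := by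
  obtain ⟨hI, hJ, hle⟩ := hIJ
  have hle' : (I.card : ℝ) ≤ J.card := by exact_mod_cast hle
  have hmn' : (m : ℝ) ≤ n := by exact_mod_cast hmn
  have hk₁ : 1 ≤ ε * I.card := hm.trans (by gcongr)
  have hk₁' : (0 : ℝ) < I.card := by
    by_contra! h
    linarith [mul_nonpos_of_nonneg_of_nonpos hε.le h]
  have hk₂ : (1 : ℝ) < J.card := hn.trans_le hJ
  have hεlog := mul_le_mul_of_nonneg_left (Real.log_le_log (by linarith) hJ) hε.le
  have hlogk₂ : 0 < Real.log J.card := Real.log_pos hk₂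
  -- Both `β` and `γ` are at most `ε / 3 * k₂` and `r` is at most `(1 - ε) * k₂`: Hall's condition
  -- has room, and at least `2 * ε / 3 * k₂` columns stay available in the greedy count.
  set β := ⌊ε * α / 3 * n⌋₊ with hβ
  set γ := ⌊ε * α / 3 * m⌋₊ with hγ
  set r := ⌊(1 - ε) * I.card⌋₊ with hr
  have hβ' : (β : ℝ) ≤ ε / 3 * J.card :=
    (Nat.floor_le (by positivity)).trans (by
      rw [mul_div_right_comm, mul_assoc]
      gcongr)
  have hγ' : (γ : ℝ) ≤ ε / 3 * J.card :=
    (Nat.floor_le (by positivity)).trans (by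
      rw [mul_div_right_comm, mul_assoc]
      exact mul_le_mul_of_nonneg_left ((mul_le_mul_of_nonneg_left hmn' hα.le).trans hJ)
        (by positivity))
  have hr' : (r : ℝ) ≤ (1 - ε) * I.card :=
    Nat.floor_le (mul_nonneg (by linarith) hk₁'.le)
  have hr'' : (1 - 2 * ε) * I.card ≤ r := by
    have := Nat.lt_floor_add_one ((1 - ε) * I.card)
    rw [← hr] at this
    linarith
  have hrk : (r : ℝ) ≤ (1 - ε) * J.card :=
    hr'.trans (mul_le_mul_of_nonneg_left hle' (by linarith))
  have hβγ : β + γ + r ≤ J.card := by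
    have : (β : ℝ) + γ + r ≤ J.card := by linarith [mul_pos hε (one_pos.trans hk₂)]
    exact_mod_cast this
  have hrI : r ≤ I.card := by
    have : (r : ℝ) ≤ I.card := hr'.trans (mul_le_of_le_one_left hk₁'.le (by linarith))
    exact_mod_cast this
  have hperm := pow_mul_pow_le_rectPerm_subMat hA ha (fun i => Nat.le_floor (hrow i))
    (fun j => Nat.le_floor (hcol j)) hrI hle hβγ
  rw [← hβ] at hperm
  set D := J.card - β - r with hD
  have hD' : (D : ℝ) = J.card - β - r := by
    rw [hD, Nat.cast_sub (by omega), Nat.cast_sub (by omega)]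
  have hDge : (J.card : ℝ) / (3 / (2 * ε)) ≤ D := by
    have : (J.card : ℝ) / (3 / (2 * ε)) = 2 * ε / 3 * J.card := by field_simp
    rw [this, hD']
    linarith
  have hpos : 0 < (J.card : ℝ) / (3 / (2 * ε)) := by positivity
  have hlogD : (1 - ε) * Real.log J.card ≤ Real.log D := by
    have h1 := Real.log_le_log hpos hDge
    rw [Real.log_div (by positivity) (by positivity)] at h1
    linarith
  have hDpos : (0 : ℝ) < D := hpos.trans_le hDge
  have hlogperm : r * Real.log D + I.card * Real.log a ≤ Real.log (rectPerm (subMat A I J)) := by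
    have := Real.log_le_log (by positivity) hperm
    rwa [Real.log_mul (by positivity) (by positivity), Real.log_pow, Real.log_pow] at this
  rw [logPermRatio, le_div_iff₀ (by positivity)]
  refine le_trans ?_ hlogperm
  have h1 : (1 - 2 * ε) * I.card * ((1 - ε) * Real.log J.card) ≤ r * Real.log D :=
    mul_le_mul hr'' hlogD (mul_nonneg (by linarith) hlogk₂.le) (Nat.cast_nonneg r)
  have h2 : I.card * (-(ε * Real.log J.card)) ≤ I.card * Real.log a :=
    mul_le_mul_of_nonneg_left (by linarith) hk₁'.le
  -- `(1 - 2ε)(1 - ε) - ε = 1 - 4ε + 2ε²`, and the square is dropped.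
  have h3 : 0 ≤ ε * ε * (I.card * Real.log J.card) := by positivity
  linarith

/-- An upper bound for `logPermRatio` in terms of the product of the row sums. -/
theorem logPermRatio_le (hA : ∀ i j, 0 ≤ A i j) (hα : 0 < α) (hε : 0 < ε)
    (hprod : ∏ i, ∑ j, (1 + |A i j|) ≤ (n : ℝ) ^ ((1 + ε) * m))
    (hm : 0 < α * m) (hn : 1 < α * n)
    (hlogα : -Real.log α ≤ ε * Real.log (α * n))
    {I : Finset (Fin m)} {J : Finset (Fin n)} (hIJ : LinearSize α I J) :
    logPermRatio A I J ≤ (1 + ε / α) * (1 + ε) := by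
  obtain ⟨hI, hJ, hle⟩ := hIJ
  have hk₁ : (0 : ℝ) < I.card := hm.trans_le hI
  have hk₂ : (1 : ℝ) < J.card := hn.trans_le hJ
  have hn₀ : (0 : ℝ) < n := by
    by_contra! h
    nlinarith
  have hlogk : Real.log (α * n) ≤ Real.log J.card := Real.log_le_log (by linarith) hJ
  have hlogk₂ : 0 < Real.log J.card := Real.log_pos hk₂
  have hlogn : Real.log n ≤ (1 + ε) * Real.log J.card := by
    rw [Real.log_mul hα.ne' hn₀.ne'] at hlogk hlogα
    nlinarith
  have hlogn₀ : 0 ≤ Real.log n := Real.log_natCast_nonneg n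
  have hrow : rectPerm (subMat A I J) ≤ ∏ i ∈ I, ∑ j, (1 + |A i j|) := by
    refine (rectPerm_le_prod_sum (B := subMat A I J) fun i j => hA i j).trans ?_
    rw [← Finset.prod_coe_sort I]
    refine Finset.prod_le_prod (fun i _ => Finset.sum_nonneg fun j _ => hA i j) fun i _ => ?_
    refine (Finset.sum_coe_sort J fun j => A i j).trans_le ?_
    refine (Finset.sum_le_sum_of_subset_of_nonneg (Finset.subset_univ J)
      fun j _ _ => hA i j).trans (Finset.sum_le_sum fun j _ => ?_)
    linarith [le_abs_self (A i j)]
  have hcompl : (n : ℝ) ^ ((m : ℝ) - I.card) ≤ ∏ i ∈ Iᶜ, ∑ j, (1 + |A i j|) := by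
    have h : ∏ i ∈ Iᶜ, (n : ℝ) ≤ ∏ i ∈ Iᶜ, ∑ j, (1 + |A i j|) := by
      refine Finset.prod_le_prod (fun _ _ => hn₀.le) fun i _ => ?_
      rw [Finset.sum_add_distrib]
      simpa using Finset.sum_nonneg fun j _ => abs_nonneg (A i j)
    rw [Finset.prod_const, Finset.card_compl, Fintype.card_fin] at h
    rwa [← Nat.cast_sub (by simpa using Finset.card_le_univ I), Real.rpow_natCast]
  rw [logPermRatio, div_le_iff₀ (by positivity)]
  have hrhs : ((I.card : ℝ) + ε * m) * Real.log n ≤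
      (1 + ε / α) * (1 + ε) * (I.card * Real.log J.card) := by
    have h1 : (I.card : ℝ) + ε * m ≤ (1 + ε / α) * I.card := by
      have : ε * m = ε / α * (α * m) := by field_simp
      rw [this]
      nlinarith [mul_le_mul_of_nonneg_left hI (div_pos hε hα).le]
    calc _ ≤ (1 + ε / α) * I.card * ((1 + ε) * Real.log J.card) :=
          mul_le_mul h1 hlogn hlogn₀ (by positivity)
      _ = _ := by ring
  refine le_trans ?_ hrhs
  have hnonneg : 0 ≤ rectPerm (subMat A I J) :=
    Finset.sum_nonneg fun f _ => Finset.prod_nonneg fun i _ => hA i (f i)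
  -- A zero permanent has logarithm 0 by convention, so it needs separate treatment.
  rcases hnonneg.eq_or_lt with h0 | h0
  · rw [← h0, Real.log_zero]
    positivity
  have hle' : rectPerm (subMat A I J) * (n : ℝ) ^ ((m : ℝ) - I.card) ≤
      (n : ℝ) ^ ((1 + ε) * m) := by
    refine le_trans ?_ hprod
    rw [← Finset.prod_mul_prod_compl I]
    exact mul_le_mul hrow hcompl (by positivity) (h0.le.trans hrow)
  have := Real.log_le_log (by positivity) hle'
  rw [Real.log_mul h0.ne' (by positivity), Real.log_rpow hn₀, Real.log_rpow hn₀] at this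
  linarith

end Deterministic

/-- Since `log log n ≤ log n`, the height condition forces `m n * log n > (log n) ^ 2`. -/
theorem eventually_log_lt_of_one_lt_liminf {m : ℕ → ℕ}
    (hheight : 1 < liminf (fun n : ℕ =>
      (((m n : ℝ) * Real.log (Real.log n) / (Real.log n) ^ 2 : ℝ) : EReal)) atTop) :
    ∀ᶠ n : ℕ in atTop, Real.log n < m n := by
  have hlog : Tendsto (fun n : ℕ => Real.log n) atTop atTop :=
    Real.tendsto_log_atTop.comp tendsto_natCast_atTop_atTop
  filter_upwards [eventually_lt_of_lt_liminf hheight, hlog.eventually_gt_atTop 0] with n hn hn₀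
  have h : (1 : ℝ) < (m n : ℝ) * Real.log (Real.log n) / (Real.log n) ^ 2 := by exact_mod_cast hn
  rw [one_lt_div (by positivity)] at h
  have h2 : Real.log (Real.log n) ≤ Real.log n := Real.log_le_self hn₀.le
  have h3 := mul_le_mul_of_nonneg_left h2 (Nat.cast_nonneg (α := ℝ) (m n))
  nlinarith

/-! ### Almost sure behaviour of the random matrices -/

section Probability

variable {Ω : Type*} [MeasurableSpace Ω] {P : Measure Ω}
  {Ω' : Type*} [MeasurableSpace Ω'] {P' : Measure Ω'} [IsProbabilityMeasure P']
  {ξ : Ω' → ℝ} {m : ℕ → ℕ} {A : (n : ℕ) → Ω → Matrix (Fin (m n)) (Fin n) ℝ}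

/-- Almost surely, all rows and columns eventually have a small proportion of small entries. -/
theorem exists_ae_eventually_ncard_le (hξm : AEMeasurable ξ P') (hξ : ∀ᵐ ω ∂P', 0 < ξ ω)
    (hm : ∀ n, m n ≤ n) (hlog : ∀ᶠ n : ℕ in atTop, Real.log n < m n)
    (hindep : ∀ n, iIndepFun (fun (p : Fin (m n) × Fin n) (ω : Ω) => A n ω p.1 p.2) P)
    (hident : ∀ (n : ℕ) (i : Fin (m n)) (j : Fin n), IdentDistrib (fun ω => A n ω i j) ξ P P')
    {η : ℝ} (hη : 0 < η) :
    ∃ a : ℝ, 0 < a ∧ ∀ᵐ ω ∂P, ∀ᶠ n : ℕ in atTop,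
      (∀ i, ({j | A n ω i j < a}.ncard : ℝ) ≤ η * n) ∧
      (∀ j, ({i | A n ω i j < a}.ncard : ℝ) ≤ η * m n) := by
  -- Chosen so that `q ^ η` absorbs the factor `2 ^ N` of the union bound: `2 ^ N * q ^ (η * N) =
  -- exp (-4 * N)`.
  set q : ℝ := (Real.exp (-4) / 2) ^ (1 / η) with hq
  have hq₀ : 0 < q := by positivity
  have hq₁ : q ≤ 1 := Real.rpow_le_one (by positivity)
    (by linarith [Real.exp_le_one_iff.2 (show (-4 : ℝ) ≤ 0 by norm_num)]) (by positivity)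
  have hqη : q ^ η = Real.exp (-4) / 2 := by
    rw [hq, ← Real.rpow_mul (by positivity), one_div_mul_cancel hη.ne', Real.rpow_one]
  obtain ⟨a, ha, hap⟩ := exists_measure_lt_le hξm hξ (p := ENNReal.ofReal q)
    (ENNReal.ofReal_pos.2 hq₀)
  refine ⟨a, ha, ?_⟩
  have hp₁ : ENNReal.ofReal q ≤ 1 := ENNReal.ofReal_le_one.2 hq₁
  have hpN : ∀ N : ℕ, (2 : ENNReal) ^ N * ENNReal.ofReal q ^ (η * N) =
      ENNReal.ofReal (Real.exp (-4 * N)) := fun N => by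
    rw [ENNReal.ofReal_rpow_of_pos hq₀, Real.rpow_mul hq₀.le, hqη, Real.rpow_natCast]
    rw [show (2 : ENNReal) = ENNReal.ofReal 2 by simp, ← ENNReal.ofReal_pow (by norm_num),
      ← ENNReal.ofReal_mul (by positivity), ← mul_pow, mul_div_cancel₀ _ two_ne_zero,
      ← Real.exp_nat_mul, mul_comm]
  have hsmall : ∀ (n : ℕ) (x : Fin (m n) × Fin n),
      P ((fun ω => A n ω x.1 x.2) ⁻¹' Set.Iio a) ≤ ENNReal.ofReal q := fun n x => by
    rw [(hident n x.1 x.2).measure_mem_eq measurableSet_Iio]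
    exact hap
  have hrow : ∀ (n : ℕ) (i : Fin (m n)),
      P {ω | η * n < ({j | A n ω i j < a}.ncard : ℝ)} ≤ ENNReal.ofReal (Real.exp (-4 * n)) :=
    fun n i => by
      have := measure_lt_card_lt_le (P := P) (X := fun (j : Fin n) ω => A n ω i j)
        ((hindep n).precomp (Prod.mk_right_injective i)) hp₁ (fun j => hsmall n (i, j)) (η * n)
      rwa [Fintype.card_fin, hpN] at this
  have hcol : ∀ (n : ℕ) (j : Fin n),
      P {ω | η * m n < ({i | A n ω i j < a}.ncard : ℝ)} ≤
        ENNReal.ofReal (Real.exp (-4 * m n)) :=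
    fun n j => by
      have := measure_lt_card_lt_le (P := P) (X := fun (i : Fin (m n)) ω => A n ω i j)
        ((hindep n).precomp (Prod.mk_left_injective j)) hp₁ (fun i => hsmall n (i, j)) (η * m n)
      rwa [Fintype.card_fin, hpN] at this
  have hBC := ae_eventually_notMem_of_le_inv_sq (P := P) (s := fun n =>
    (⋃ i, {ω | η * n < ({j | A n ω i j < a}.ncard : ℝ)}) ∪
    (⋃ j, {ω | η * m n < ({i | A n ω i j < a}.ncard : ℝ)})) (by
      filter_upwards [hlog, eventually_ge_atTop 2] with n hn hn₂
      have hn₂' : (2 : ℝ) ≤ n := by exact_mod_cast hn₂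
      have hmn : (m n : ℝ) ≤ n := by exact_mod_cast hm n
      -- Here `log n < m n` is used; the fourth power pays for the at most `2 * n` rows and columns
      -- and leaves `1 / n ^ 2`.
      have hexp : Real.exp (-4 * m n) ≤ 1 / (n : ℝ) ^ 4 := by
        rw [← Real.exp_log (show (0 : ℝ) < n by linarith), ← Real.exp_nat_mul, one_div,
          ← Real.exp_neg]
        refine Real.exp_le_exp.2 ?_
        push_cast
        linarith
      have hexp' : Real.exp (-4 * n) ≤ 1 / (n : ℝ) ^ 4 :=
        (Real.exp_le_exp.2 (by linarith)).trans hexp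
      calc _ ≤ ∑ i : Fin (m n), P {ω | η * n < ({j | A n ω i j < a}.ncard : ℝ)} +
            ∑ j : Fin n, P {ω | η * m n < ({i | A n ω i j < a}.ncard : ℝ)} :=
            (measure_union_le _ _).trans
              (add_le_add (measure_iUnion_fintype_le _ _) (measure_iUnion_fintype_le _ _))
        _ ≤ ∑ i : Fin (m n), ENNReal.ofReal (1 / (n : ℝ) ^ 4) +
            ∑ j : Fin n, ENNReal.ofReal (1 / (n : ℝ) ^ 4) :=
            add_le_add
              (Finset.sum_le_sum fun i _ => (hrow n i).trans (ENNReal.ofReal_le_ofReal hexp'))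
              (Finset.sum_le_sum fun j _ => (hcol n j).trans (ENNReal.ofReal_le_ofReal hexp))
        _ = ENNReal.ofReal ((m n + n) * (1 / (n : ℝ) ^ 4)) := by
            rw [ENNReal.ofReal_mul (by positivity), ENNReal.ofReal_add (by positivity)
              (by positivity)]
            simp [add_mul]
        _ ≤ ENNReal.ofReal (1 / (n : ℝ) ^ 2) := by
            refine ENNReal.ofReal_le_ofReal ?_
            rw [mul_one_div, div_le_div_iff₀ (by positivity) (by positivity)]
            have : (m n : ℝ) + n ≤ n ^ 2 := by nlinarith
            nlinarith [mul_le_mul_of_nonneg_right this (sq_nonneg (n : ℝ))])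
  filter_upwards [hBC] with ω hω
  filter_upwards [hω] with n hn
  simpa [not_or, not_exists] using hn

/-- Almost surely, the products of the row sums are eventually not much larger than `n ^ m`. -/
theorem ae_eventually_prod_sum_le [IsProbabilityMeasure P] (hξ : Integrable ξ P')
    (hlog : ∀ᶠ n : ℕ in atTop, Real.log n < m n)
    (hindep : ∀ n, iIndepFun (fun (p : Fin (m n) × Fin n) (ω : Ω) => A n ω p.1 p.2) P)
    (hident : ∀ (n : ℕ) (i : Fin (m n)) (j : Fin n), IdentDistrib (fun ω => A n ω i j) ξ P P')
    {ε : ℝ} (hε : 0 < ε) :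
    ∀ᵐ ω ∂P, ∀ᶠ n : ℕ in atTop,
      ∏ i, ∑ j, (1 + |A n ω i j|) ≤ (n : ℝ) ^ ((1 + ε) * m n) := by
  set g : ℝ → ENNReal := fun x => ENNReal.ofReal (1 + |x|) with hg
  have hgm : Measurable g := by fun_prop
  set C : ℝ := ∫ ω, (1 + |ξ ω|) ∂P' with hC
  have hint : Integrable (fun ω => 1 + |ξ ω|) P' := (integrable_const 1).add hξ.abs
  have hC₀ : 0 ≤ C := integral_nonneg fun ω => by positivity
  have hgξ : ∫⁻ ω, g (ξ ω) ∂P' = ENNReal.ofReal C :=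
    (ofReal_integral_eq_lintegral_ofReal hint (ae_of_all _ fun ω => by positivity)).symm
  have hlogn : Tendsto (fun n : ℕ => Real.log n) atTop atTop :=
    Real.tendsto_log_atTop.comp tendsto_natCast_atTop_atTop
  have hBC := ae_eventually_notMem_of_le_inv_sq (P := P) (s := fun n =>
    {ω | ENNReal.ofReal ((n : ℝ) ^ ((1 + ε) * m n)) ≤ ∏ i, ∑ j, g (A n ω i j)}) (by
      have hCn : ∀ᶠ n : ℕ in atTop, C ≤ (n : ℝ) ^ (ε / 2) :=
        ((tendsto_rpow_atTop (half_pos hε)).comp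
          tendsto_natCast_atTop_atTop).eventually_ge_atTop C
      filter_upwards [hlog, hCn, hlogn.eventually_ge_atTop (4 / ε), eventually_ge_atTop 1]
        with n hn hCn hlogn hn₁
      have hn₁' : (1 : ℝ) ≤ n := by exact_mod_cast hn₁
      have hn₀ : (0 : ℝ) < n := by linarith
      -- Half of the excess exponent `ε * m n` absorbs `C ^ m n`; the other half is at least 2, as
      -- Borel–Cantelli requires.
      have hmε : 4 ≤ m n * ε := by
        rw [← div_le_iff₀ hε]
        linarith
      have hgA : ∀ x : Fin (m n) × Fin n, AEMeasurable (fun ω => g (A n ω x.1 x.2)) P :=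
        fun x => hgm.comp_aemeasurable (hident n x.1 x.2).aemeasurable_fst
      have hE := lintegral_prod_sum_eq (P := P)
        (X := fun (x : Fin (m n) × Fin n) ω => g (A n ω x.1 x.2))
        ((hindep n).comp (fun _ => g) fun _ => hgm) hgA (c := ENNReal.ofReal C)
        fun x => (((hident n x.1 x.2).comp hgm).lintegral_eq).trans hgξ
      rw [Fintype.card_fin, Fintype.card_fin] at hE
      refine (meas_ge_le_lintegral_div (Finset.aemeasurable_fun_prod _ fun i _ =>
        Finset.aemeasurable_fun_sum _ fun j _ => hgA (i, j))
        (ENNReal.ofReal_pos.2 (by positivity)).ne' ENNReal.ofReal_ne_top).trans ?_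
      rw [hE, show (n : ENNReal) = ENNReal.ofReal n by simp, ← ENNReal.ofReal_mul hn₀.le,
        ← ENNReal.ofReal_pow (by positivity), ← ENNReal.ofReal_div_of_pos (by positivity)]
      refine ENNReal.ofReal_le_ofReal ?_
      rw [div_le_div_iff₀ (by positivity) (by positivity), one_mul]
      calc (n * C) ^ m n * (n : ℝ) ^ 2 ≤ (n * (n : ℝ) ^ (ε / 2)) ^ m n * (n : ℝ) ^ 2 := by gcongr
        _ = (n : ℝ) ^ ((1 + ε / 2) * m n + 2) := by
            rw [Real.rpow_add hn₀, Real.rpow_mul hn₀.le, Real.rpow_natCast, Real.rpow_add hn₀,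
              Real.rpow_one, Real.rpow_two]
        _ ≤ (n : ℝ) ^ ((1 + ε) * m n) :=
            Real.rpow_le_rpow_of_exponent_le hn₁' (by linarith))
  filter_upwards [hBC] with ω hω
  filter_upwards [hω] with n hn
  have hprod : ∏ i, ∑ j, g (A n ω i j) = ENNReal.ofReal (∏ i, ∑ j, (1 + |A n ω i j|)) := by
    rw [ENNReal.ofReal_prod_of_nonneg fun i _ => Finset.sum_nonneg fun j _ => by positivity]
    exact Finset.prod_congr rfl fun i _ =>
      (ENNReal.ofReal_sum_of_nonneg fun j _ => by positivity).symm
  by_contra! h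
  refine hn ?_
  rw [hprod]
  exact ENNReal.ofReal_le_ofReal h.le

end Probability

/-! ### Passage to the limit and the main theorem -/

/-- Criterion for a lower bound of a liminf in the extended reals. -/
theorem one_le_liminf_of_forall_one_sub {u : ℕ → EReal}
    (h : ∀ k : ℕ, ∀ᶠ n in atTop, ((1 - 1 / ((k : ℝ) + 1) : ℝ) : EReal) ≤ u n) :
    1 ≤ liminf u atTop := by
  have hlim : Tendsto (fun k : ℕ => ((1 - 1 / ((k : ℝ) + 1) : ℝ) : EReal)) atTop (nhds 1) := by
    have := (tendsto_one_div_add_atTop_nhds_zero_nat (𝕜 := ℝ)).const_sub 1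
    rw [sub_zero] at this
    exact (continuous_coe_real_ereal.tendsto 1).comp this
  exact le_of_tendsto' hlim fun k => le_liminf_of_le (by isBoundedDefault) (h k)

/-- Criterion for an upper bound of a limsup in the extended reals. -/
theorem limsup_le_one_of_forall_one_add {u : ℕ → EReal}
    (h : ∀ k : ℕ, ∀ᶠ n in atTop, u n ≤ ((1 + 1 / ((k : ℝ) + 1) : ℝ) : EReal)) :
    limsup u atTop ≤ 1 := by
  have hlim : Tendsto (fun k : ℕ => ((1 + 1 / ((k : ℝ) + 1) : ℝ) : EReal)) atTop (nhds 1) := by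
    have := (tendsto_one_div_add_atTop_nhds_zero_nat (𝕜 := ℝ)).const_add 1
    rw [add_zero] at this
    exact (continuous_coe_real_ereal.tendsto 1).comp this
  exact ge_of_tendsto' hlim fun k => limsup_le_of_le (by isBoundedDefault) (h k)

theorem minLogPermRatio_le_maxLogPermRatio {α : ℝ} (hα : α ≤ 1) {m n : ℕ} (hmn : m ≤ n)
    (A : Matrix (Fin m) (Fin n) ℝ) : minLogPermRatio α A ≤ maxLogPermRatio α A :=
  (iInf₂_le (Finset.univ, Finset.univ) (linearSize_univ hα hmn)).trans
    (le_iSup₂_of_le (Finset.univ, Finset.univ) (linearSize_univ hα hmn) le_rfl)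

theorem mainTheorem4
    {Ω : Type*} [MeasurableSpace Ω] (P : Measure Ω) [IsProbabilityMeasure P]
    {Ω' : Type*} [MeasurableSpace Ω'] (P' : Measure Ω') [IsProbabilityMeasure P']
    -- the generic positive random variable
    (ξ : Ω' → ℝ) (hξ : ∀ᵐ ω ∂P', 0 < ξ ω)
    -- the heights; the liminf in the condition is taken in the extended reals
    (m : ℕ → ℕ) (hm : ∀ n, m n ≤ n)
    (hheight : 1 < liminf (fun n : ℕ =>
      (((m n : ℝ) * Real.log (Real.log n) / (Real.log n) ^ 2 : ℝ) : EReal)) atTop)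
    -- for each `n`, the entries of the `m n × n` matrix `A n` are i.i.d. with the law of `ξ`;
    -- nothing is assumed about the joint law of different matrices
    (A : (n : ℕ) → Ω → Matrix (Fin (m n)) (Fin n) ℝ)
    (hindep : ∀ n, iIndepFun (fun (p : Fin (m n) × Fin n) (ω : Ω) => A n ω p.1 p.2) P)
    (hident : ∀ (n : ℕ) (i : Fin (m n)) (j : Fin n),
      IdentDistrib (fun ω => A n ω i j) ξ P P')
    (α : ℝ) (hα₀ : 0 < α) (hα₁ : α < 1) :
    (∀ᵐ ω ∂P, 1 ≤ liminf (fun n : ℕ => minLogPermRatio α (A n ω)) atTop) ∧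
    (Integrable ξ P' →
      ∀ᵐ ω ∂P, limsup (fun n : ℕ => maxLogPermRatio α (A n ω)) atTop = 1) := by
  have hlog := eventually_log_lt_of_one_lt_liminf hheight
  have hlogn : Tendsto (fun n : ℕ => Real.log n) atTop atTop :=
    Real.tendsto_log_atTop.comp tendsto_natCast_atTop_atTop
  have hmtop : Tendsto (fun n => α * (m n : ℝ)) atTop atTop :=
    (tendsto_atTop_mono' _ (hlog.mono fun n h => h.le) hlogn).const_mul_atTop hα₀
  have hntop : Tendsto (fun n : ℕ => α * (n : ℝ)) atTop atTop :=
    tendsto_natCast_atTop_atTop.const_mul_atTop hα₀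
  have hαlog : Tendsto (fun n : ℕ => Real.log (α * n)) atTop atTop :=
    Real.tendsto_log_atTop.comp hntop
  -- Measurability of `ξ` is inherited from equality in law with an entry of some nonempty `A n`.
  have hξm : AEMeasurable ξ P' := by
    obtain ⟨n, hn⟩ := (hmtop.eventually_gt_atTop 0).exists
    have hmn : 0 < m n := by
      by_contra! h
      simp [Nat.le_zero.1 h] at hn
    exact (hident n ⟨0, hmn⟩ ⟨0, hmn.trans_le (hm n)⟩).aemeasurable_snd
  have hpos : ∀ᵐ ω ∂P, ∀ n i j, 0 ≤ A n ω i j := by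
    simp only [ae_all_iff]
    exact fun n i j => ((hident n i j).symm.ae_mem_snd measurableSet_Ioi hξ).mono
      fun ω hω => le_of_lt hω
  have hmin : ∀ᵐ ω ∂P, 1 ≤ liminf (fun n : ℕ => minLogPermRatio α (A n ω)) atTop := by
    have h : ∀ k : ℕ, ∀ᵐ ω ∂P, ∀ᶠ n in atTop,
        ((1 - 1 / ((k : ℝ) + 1) : ℝ) : EReal) ≤ minLogPermRatio α (A n ω) := fun k => by
      set ε : ℝ := 1 / ((k : ℝ) + 1) / 4 with hε
      have hε₀ : 0 < ε := by positivity
      have hε₁ : ε ≤ 1 / 4 := by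
        have : 1 / ((k : ℝ) + 1) ≤ 1 := by
          rw [div_le_one (by positivity)]
          linarith [Nat.cast_nonneg (α := ℝ) k]
        linarith
      obtain ⟨a, ha, hfew⟩ := exists_ae_eventually_ncard_le hξm hξ hm hlog hindep hident
        (η := ε * α / 3) (by positivity)
      filter_upwards [hpos, hfew] with ω hω hfew
      filter_upwards [hfew, (hmtop.const_mul_atTop hε₀).eventually_ge_atTop 1,
        hntop.eventually_gt_atTop 1,
        (hαlog.const_mul_atTop hε₀).eventually_ge_atTop (Real.log (3 / (2 * ε))),
        (hαlog.const_mul_atTop hε₀).eventually_ge_atTop (-Real.log a)] with n h₁ h₂ h₃ h₄ h₅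
      refine le_iInf₂ fun p hp => EReal.coe_le_coe_iff.2 ?_
      have := one_sub_le_logPermRatio (hm n) (hω n) ha hα₀ hε₀ hε₁ h₁.1 h₁.2 h₂ h₃ h₄ h₅ hp
      linarith
    filter_upwards [ae_all_iff.2 h] with ω hω
    exact one_le_liminf_of_forall_one_sub hω
  refine ⟨hmin, fun hint => ?_⟩
  have hmax : ∀ᵐ ω ∂P, limsup (fun n : ℕ => maxLogPermRatio α (A n ω)) atTop ≤ 1 := by
    have h : ∀ k : ℕ, ∀ᵐ ω ∂P, ∀ᶠ n in atTop,
        maxLogPermRatio α (A n ω) ≤ ((1 + 1 / ((k : ℝ) + 1) : ℝ) : EReal) := fun k => by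
      set δ : ℝ := 1 / ((k : ℝ) + 1) with hδ
      have hδ₀ : 0 < δ := by positivity
      have hδ₁ : δ ≤ 1 := by
        rw [hδ, div_le_one (by positivity)]
        linarith [Nat.cast_nonneg (α := ℝ) k]
      -- This gives `(1 + ε / α) * (1 + ε) ≤ (1 + δ / 4) ^ 2 ≤ 1 + δ`, as `δ ≤ 1`.
      set ε : ℝ := δ / 4 * α with hε
      have hε₀ : 0 < ε := by positivity
      have hεα : ε / α = δ / 4 := by rw [hε]; field_simp
      have hε₁ : ε ≤ δ / 4 := by nlinarith
      filter_upwards [hpos, ae_eventually_prod_sum_le hint hlog hindep hident hε₀]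
        with ω hω hprod
      filter_upwards [hprod, hmtop.eventually_gt_atTop 0, hntop.eventually_gt_atTop 1,
        (hαlog.const_mul_atTop hε₀).eventually_ge_atTop (-Real.log α)] with n h₁ h₂ h₃ h₄
      refine iSup₂_le fun p hp => EReal.coe_le_coe_iff.2 ?_
      have := logPermRatio_le (hω n) hα₀ hε₀ h₁ h₂ h₃ h₄ hp
      rw [hεα] at this
      nlinarith
    filter_upwards [ae_all_iff.2 h] with ω hω
    exact limsup_le_one_of_forall_one_add hω
  filter_upwards [hmin, hmax] with ω h₁ h₂
  -- The limsup of the maxima is at least their liminf, which dominates the liminf of the minima, so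
  -- part (i) gives the lower bound.
  refine le_antisymm h₂ (h₁.trans (le_trans ?_ liminf_le_limsup))
  exact liminf_le_liminf (Eventually.of_forall fun n =>
    minLogPermRatio_le_maxLogPermRatio hα₁.le (hm n) (A n ω))
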